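/- **Proposition (Direct Galois closure).** Let $(R,\varsigma)$ be a transformal domain, i.e. an integral domain $R$ with an injective endomorphism $\varsigma$, and let $S=\operatorname{Spec}R$. *Notions.* An algebraic variety over $R$ is a reduced separated $S$-scheme of finite presentation. An almost direct presentation $(X,\Sigma)$ over $(R,\varsigma)$ consists of algebraic varieties $X_0,X_1$ over $R$, an $S$-morphism $\pi_1:X_1\to X_0$ and a family $\Sigma$ of morphisms $\sigma:X_1\to X_0$ lying over $\operatorname{Spec}(\varsigma):S\to S$. A morphism $f:(X,\Sigma)\to(Y,T)$ consists of a map $()^f:\Sigma\to T$ and $S$-morphisms $f_0:X_0\to Y_0$, $f_1:X_1\to Y_1$ with $f_0\pi_1=\pi_1f_1$ and $f_0\sigma=\sigma^ff_1$ for $\sigma\in\Sigma$. Write $X_{0\varsigma}$ for the base change of $X_0$ along $\operatorname{Spec}(\varsigma)$, $f_{0\varsigma}$ for that of $f_0$, and $\pi_2(\sigma):X_1\to X_{0\varsigma}$ for the $S$-morphism induced by $\sigma$. "Directly $P$" means that $X_0,X_1,X_{0\varsigma}$ (respectively $f_0,f_1,f_{0\varsigma}$) have property $P$. When $\Sigma=\{\sigma\}$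 one writes $(X,\sigma)$. A Galois cover is a finite étale surjective morphism $Z\to W$ with $Z$ connected such that $\operatorname{Gal}(Z/W)=\operatorname{Aut}(Z/W)$ acts transitively on geometric fibres. The Galois closure of $Z\to W$ is a Galois cover $\tilde Z\to W$ with a $W$-morphism $\tilde Z\to Z$ through which every $W$-morphism to $Z$ from a Galois cover of $W$ factors. An almost direct Galois cover is a morphism $p:(X,\Sigma)\to(Y,T)$ of almost direct presentations such that (1) $X_i\to Y_i$ is a Galois cover, with group $G_i$, for $i=0,1$; (2) $G_0$ acts on $\Sigma$ by composition, $g\cdot\sigma=g\sigma$, and $()^p$ induces a bijection $G_0\backslash\Sigma\simeq T$; (3) there is a homomorphism $()^{\pi_1}:G_1\to G_0$ with $\pi_1g=g^{\pi_1}\pi_1$ for $g\in G_1$; (4) for every $\sigma\in\Sigma$ there is a homomorphism $()^\sigma:G_1\to G_0$ with $\sigma g=g^\sigma\sigma$ for $g\in G_1$. *Statement.* Let $f:(X,\sigma)\to(Y,\sigma)$ be a directly finite étale morphism of directly integral almost direct presentations over $(R,\varsigma)$. Then the Galois closures of $X_0\to Y_0$ and of $X_{0\varsigma}\to Y_{0\varsigma}$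 exist. For any choice $\tilde X_0\to X_0$ and $\tilde X_{0\varsigma}\to X_{0\varsigma}$ of them, consider the morphism (products without index are over $S$) $$\psi:\ A=(\tilde X_0\times\tilde X_{0\varsigma})\times_{X_0\times X_{0\varsigma}}X_1\ \longrightarrow\ B=(\tilde X_0\times\tilde X_{0\varsigma})\times_{Y_0\times Y_{0\varsigma}}Y_1$$ induced by $f_1$ and the identities, where $X_1\to X_0\times X_{0\varsigma}$ and $Y_1\to Y_0\times Y_{0\varsigma}$ are $(\pi_1,\pi_2(\sigma))$. Then the following hold. 1. $A$ has an open connected component, and every open connected component of $A$ is mapped by $\psi$ into some open connected component of $B$. 2. There is a morphism $c:\tilde X_{0\varsigma}\to\tilde X_0$ lying over the projection $X_{0\varsigma}\to X_0$. 3. Let $c$ be any such morphism, let $\mathring{\tilde X}_1$ be any open connected component of $A$, and let $\tilde X_1$ be an open connected component of $B$ that contains $\psi(\mathring{\tilde X}_1)$. On $\mathring{\tilde X}_1$ and on $\tilde X_1$ let $\pi_1$ and $\pi_2$ be the projections to $\tilde X_0$ and $\tilde X_{0\varsigma}$. Put $$\mathring{\tilde X}=(\tilde X_0,\mathring{\tilde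 X}_1,\pi_1),\quad \mathring\Sigma=\operatorname{Gal}(\tilde X_0/X_0)\,c\,\pi_2,\qquad \tilde X=(\tilde X_0,\tilde X_1,\pi_1),\quad \tilde\Sigma=\operatorname{Gal}(\tilde X_0/Y_0)\,c\,\pi_2 .$$ Then the projections $(\mathring{\tilde X},\mathring\Sigma)\to(X,\sigma)$ and $(\tilde X,\tilde\Sigma)\to(Y,\sigma)$ are almost direct Galois covers (in particular, morphisms of almost direct presentations), and there is a morphism $(\mathring{\tilde X},\mathring\Sigma)\to(\tilde X,\tilde\Sigma)$, given by $\mathrm{id}_{\tilde X_0}$ and the restriction of $\psi$, such that the square formed with $f$ and the two covers commutes. -/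

import Mathlib

open CategoryTheory CategoryTheory.Limits AlgebraicGeometry

universe u

/-! ### Varieties, finite étale morphisms, Galois covers and Galois closures -/

/-- `X` is an algebraic variety over `S` via `s`: reduced, separated and of finite presentation. -/
structure IsAlgebraicVariety {X S : Scheme.{u}} (s : X ⟶ S) : Prop where
  isReduced : IsReduced X
  isSeparated : IsSeparated s
  locallyOfFinitePresentation : LocallyOfFinitePresentation s
  quasiCompact : QuasiCompact s

/-- Finite étale morphisms of schemes. -/
def finiteEtale : MorphismProperty Scheme.{u} := fun _ _ p => IsFinite p ∧ Etale p

/-- `p : X ⟶ Y` is a (finite étale, connected) Galois cover: the group `Aut (X/Y)` acts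
transitively on the geometric points of `X` over any given geometric point of `Y`. -/
structure IsGaloisCover {X Y : Scheme.{u}} (p : X ⟶ Y) : Prop where
  finiteEtale : finiteEtale p
  surjective : Surjective p
  connected : ConnectedSpace X
  transitive : ∀ (Ω : Type u) [Field Ω] [IsAlgClosed Ω] (x x' : Spec (CommRingCat.of Ω) ⟶ X),
    x ≫ p = x' ≫ p → ∃ g : Aut (Over.mk p), x ≫ g.hom.left = x'

/-- `q : P ⟶ X` exhibits `P` as the Galois closure of the cover `f : X ⟶ Y`: `P` is a Galois cover
of `Y` via `q ≫ f`, and every Galois cover of `Y` that dominates `X` factors through `P`. -/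
structure IsGaloisClosure {P X Y : Scheme.{u}} (q : P ⟶ X) (f : X ⟶ Y) : Prop where
  isGaloisCover : IsGaloisCover (q ≫ f)
  dominated : ∀ {Z : Scheme.{u}} (h : Z ⟶ X), IsGaloisCover (h ≫ f) → ∃ v : Z ⟶ P, v ≫ q = h

/-- The open subset `U` of `X` is a connected component of `X`. -/
def IsComponent {X : Scheme.{u}} (U : X.Opens) : Prop :=
  ∃ x : X, (U : Set X) = connectedComponent x

/-! ### Almost direct presentations -/

/-- The diagrams underlying almost direct presentations over the difference ring `(R, ς)`:
two schemes `X₀`, `X₁` over `S = Spec R`, an `S`-morphism `π₁ : X₁ ⟶ X₀`, and a family of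
morphisms `σ s : X₁ ⟶ X₀` which lie over `Spec ς : S ⟶ S`. -/
structure TwistedDiagram {R : Type u} [CommRing R] (ς : R →+* R) : Type (u + 1) where
  X₀ : Scheme.{u}
  X₁ : Scheme.{u}
  str₀ : X₀ ⟶ Spec (CommRingCat.of R)
  str₁ : X₁ ⟶ Spec (CommRingCat.of R)
  π₁ : X₁ ⟶ X₀
  /-- The index set of the family of twisted morphisms. -/
  Idx : Type u
  σ : Idx → (X₁ ⟶ X₀)
  π₁_str : π₁ ≫ str₀ = str₁
  σ_str : ∀ s, σ s ≫ str₀ = str₁ ≫ Spec.map (CommRingCat.ofHom ς)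

namespace TwistedDiagram

variable {R : Type u} [CommRing R] {ς : R →+* R}

/-- Morphisms `(X, Σ) ⟶ (Y, T)`: a map `Σ → T` and `S`-morphisms `X₀ ⟶ Y₀` and `X₁ ⟶ Y₁`
which commute with all the structure. -/
@[ext]
structure Hom (X Y : TwistedDiagram.{u} ς) where
  idx : X.Idx → Y.Idx
  f₀ : X.X₀ ⟶ Y.X₀
  f₁ : X.X₁ ⟶ Y.X₁
  f₀_str : f₀ ≫ Y.str₀ = X.str₀
  f₁_str : f₁ ≫ Y.str₁ = X.str₁
  π₁_comm : X.π₁ ≫ f₀ = f₁ ≫ Y.π₁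
  σ_comm : ∀ s, X.σ s ≫ f₀ = f₁ ≫ Y.σ (idx s)

instance : Category (TwistedDiagram.{u} ς) where
  Hom := Hom
  id X :=
    { idx := id
      f₀ := 𝟙 _
      f₁ := 𝟙 _
      f₀_str := by simp
      f₁_str := by simp
      π₁_comm := by simp
      σ_comm := by simp }
  comp f g :=
    { idx := g.idx ∘ f.idx
      f₀ := f.f₀ ≫ g.f₀
      f₁ := f.f₁ ≫ g.f₁
      f₀_str := by rw [Category.assoc, g.f₀_str, f.f₀_str]
      f₁_str := by rw [Category.assoc, g.f₁_str, f.f₁_str]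
      π₁_comm := by rw [← Category.assoc, f.π₁_comm, Category.assoc, g.π₁_comm, Category.assoc]
      σ_comm := fun s => by
        rw [← Category.assoc, f.σ_comm, Category.assoc, g.σ_comm, Category.assoc]
        rfl }
  id_comp f := by apply Hom.ext <;> simp
  comp_id f := by apply Hom.ext <;> simp
  assoc f g h := by apply Hom.ext <;> simp [Function.comp_assoc]

/-- The objects of the category of almost direct presentations (a full subcategory): `X₀` and `X₁`
are algebraic varieties over `R`. -/
structure IsAlmostDirectPresentation (X : TwistedDiagram.{u} ς) : Prop where
  variety₀ : IsAlgebraicVariety X.str₀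
  variety₁ : IsAlgebraicVariety X.str₁

/-- The base change `X_{0ς}` of `X₀` along `Spec ς : S ⟶ S`. -/
noncomputable def twist (X : TwistedDiagram.{u} ς) : Scheme.{u} :=
  pullback X.str₀ (Spec.map (CommRingCat.ofHom ς))

/-- The structure morphism `X_{0ς} ⟶ S`. -/
noncomputable def twistStr (X : TwistedDiagram.{u} ς) : X.twist ⟶ Spec (CommRingCat.of R) :=
  pullback.snd X.str₀ (Spec.map (CommRingCat.ofHom ς))

/-- The projection `X_{0ς} ⟶ X₀`, which lies over `Spec ς`. -/
noncomputable def twistProj (X : TwistedDiagram.{u} ς) : X.twist ⟶ X.X₀ :=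
  pullback.fst X.str₀ (Spec.map (CommRingCat.ofHom ς))

lemma twist_condition (X : TwistedDiagram.{u} ς) :
    X.twistProj ≫ X.str₀ = X.twistStr ≫ Spec.map (CommRingCat.ofHom ς) :=
  pullback.condition

/-- The `S`-morphism `π₂(σ) : X₁ ⟶ X_{0ς}` induced by `σ : X₁ ⟶ X₀`. -/
noncomputable def π₂ (X : TwistedDiagram.{u} ς) (s : X.Idx) : X.X₁ ⟶ X.twist :=
  pullback.lift (X.σ s) X.str₁ (X.σ_str s)

lemma π₂_twistProj (X : TwistedDiagram.{u} ς) (s : X.Idx) : X.π₂ s ≫ X.twistProj = X.σ s :=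
  pullback.lift_fst _ _ _

lemma π₂_twistStr (X : TwistedDiagram.{u} ς) (s : X.Idx) : X.π₂ s ≫ X.twistStr = X.str₁ :=
  pullback.lift_snd _ _ _

/-- The base change `f_{0ς} : X_{0ς} ⟶ Y_{0ς}` of `f₀`. -/
noncomputable def Hom.twist {X Y : TwistedDiagram.{u} ς} (f : X ⟶ Y) : X.twist ⟶ Y.twist :=
  pullback.lift (X.twistProj ≫ f.f₀) X.twistStr
    (by rw [Category.assoc, f.f₀_str, X.twist_condition])

lemma Hom.twist_twistProj {X Y : TwistedDiagram.{u} ς} (f : X ⟶ Y) :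
    Hom.twist f ≫ Y.twistProj = X.twistProj ≫ f.f₀ :=
  pullback.lift_fst _ _ _

lemma Hom.twist_twistStr {X Y : TwistedDiagram.{u} ς} (f : X ⟶ Y) :
    Hom.twist f ≫ Y.twistStr = X.twistStr :=
  pullback.lift_snd _ _ _

lemma Hom.π₂_comm {X Y : TwistedDiagram.{u} ς} (f : X ⟶ Y) (s : X.Idx) :
    X.π₂ s ≫ Hom.twist f = f.f₁ ≫ Y.π₂ (f.idx s) := by
  apply pullback.hom_ext
  · change (X.π₂ s ≫ Hom.twist f) ≫ Y.twistProj = (f.f₁ ≫ Y.π₂ (f.idx s)) ≫ Y.twistProj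
    rw [Category.assoc, Hom.twist_twistProj, ← Category.assoc, π₂_twistProj, Category.assoc,
      π₂_twistProj, f.σ_comm]
  · change (X.π₂ s ≫ Hom.twist f) ≫ Y.twistStr = (f.f₁ ≫ Y.π₂ (f.idx s)) ≫ Y.twistStr
    rw [Category.assoc, Hom.twist_twistStr, π₂_twistStr, Category.assoc, π₂_twistStr, f.f₁_str]

/-- `X` is directly `P`: the schemes `X₀`, `X₁` and `X_{0ς}` have the property `P`. -/
def IsDirectly (P : Scheme.{u} → Prop) (X : TwistedDiagram.{u} ς) : Prop :=
  P X.X₀ ∧ P X.X₁ ∧ P X.twist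

/-- `f` is directly `P`: the morphisms `f₀`, `f₁` and `f_{0ς}` have the property `P`. -/
def Hom.IsDirectly (P : MorphismProperty Scheme.{u}) {X Y : TwistedDiagram.{u} ς} (f : X ⟶ Y) :
    Prop :=
  P f.f₀ ∧ P f.f₁ ∧ P (Hom.twist f)

/-- Almost direct Galois covers. Products in `Aut` are compositions, so that `g • σ = g ∘ σ` is a
left action. -/
structure IsAlmostDirectGaloisCover {X Y : TwistedDiagram.{u} ς} (p : X ⟶ Y) : Prop where
  source : X.IsAlmostDirectPresentation
  target : Y.IsAlmostDirectPresentation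
  galois₀ : IsGaloisCover p.f₀
  galois₁ : IsGaloisCover p.f₁
  /-- `G₀` acts on the twisted morphisms of `X` by composition, and `Y.Idx` is the orbit set. -/
  action : ∃ _ : MulAction (Aut (Over.mk p.f₀)) X.Idx,
    (∀ (g : Aut (Over.mk p.f₀)) (s : X.Idx), X.σ (g • s) = X.σ s ≫ g.hom.left) ∧
    Function.Surjective p.idx ∧
    ∀ s s' : X.Idx, p.idx s = p.idx s' ↔ ∃ g : Aut (Over.mk p.f₀), g • s = s'
  /-- The homomorphism `G₁ → G₀` which belongs to `π₁`. -/
  hom_π₁ : ∃ φ : Aut (Over.mk p.f₁) →* Aut (Over.mk p.f₀),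
    ∀ g, g.hom.left ≫ X.π₁ = X.π₁ ≫ (φ g).hom.left
  /-- The homomorphisms `G₁ → G₀` which belong to the twisted morphisms. -/
  hom_σ : ∀ s : X.Idx, ∃ φ : Aut (Over.mk p.f₁) →* Aut (Over.mk p.f₀),
    ∀ g, g.hom.left ≫ X.σ s = X.σ s ≫ (φ g).hom.left

/-! ### The construction of the direct Galois closure -/

/-- The object `(Z, Aut (Z₀/Y₀) τ)` over `(Y, σ)`, given by morphisms `Z₀ ⟶ Y₀`, `Z₁ ⟶ Y₁`, a
lift `ϖ : Z₁ ⟶ Z₀` of `π₁` and a lift `τ : Z₁ ⟶ Z₀` of `σ`. -/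
noncomputable def orbitObj (Y : TwistedDiagram.{u} ς) (t : Y.Idx) {Z₀ Z₁ : Scheme.{u}} (p₀ : Z₀ ⟶ Y.X₀)
    (p₁ : Z₁ ⟶ Y.X₁) (ϖ τ : Z₁ ⟶ Z₀) (hϖ : ϖ ≫ p₀ = p₁ ≫ Y.π₁)
    (hτ : τ ≫ p₀ = p₁ ≫ Y.σ t) : TwistedDiagram.{u} ς where
  X₀ := Z₀
  X₁ := Z₁
  str₀ := p₀ ≫ Y.str₀
  str₁ := p₁ ≫ Y.str₁
  π₁ := ϖ
  Idx := {ρ : Z₁ ⟶ Z₀ // ∃ g : Aut (Over.mk p₀), ρ = τ ≫ g.hom.left}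
  σ := fun ρ => ρ.1
  π₁_str := by rw [← Category.assoc, hϖ, Category.assoc, Y.π₁_str]
  σ_str := by
    rintro ⟨ρ, g, rfl⟩
    have hg : g.hom.left ≫ p₀ = p₀ := Over.w g.hom
    change (τ ≫ g.hom.left) ≫ p₀ ≫ Y.str₀ = _
    rw [Category.assoc, ← Category.assoc g.hom.left, hg, ← Category.assoc τ, hτ, Category.assoc,
      Y.σ_str, Category.assoc]

/-- The morphism `(Z, Aut (Z₀/Y₀) τ) ⟶ (Y, σ)`. -/
noncomputable def orbitMap (Y : TwistedDiagram.{u} ς) (t : Y.Idx) {Z₀ Z₁ : Scheme.{u}} (p₀ : Z₀ ⟶ Y.X₀)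
    (p₁ : Z₁ ⟶ Y.X₁) (ϖ τ : Z₁ ⟶ Z₀) (hϖ : ϖ ≫ p₀ = p₁ ≫ Y.π₁)
    (hτ : τ ≫ p₀ = p₁ ≫ Y.σ t) : Y.orbitObj t p₀ p₁ ϖ τ hϖ hτ ⟶ Y where
  idx := fun _ => t
  f₀ := p₀
  f₁ := p₁
  f₀_str := rfl
  f₁_str := rfl
  π₁_comm := hϖ
  σ_comm := by
    rintro ⟨ρ, g, rfl⟩
    have hg : g.hom.left ≫ p₀ = p₀ := Over.w g.hom
    change (τ ≫ g.hom.left) ≫ p₀ = p₁ ≫ Y.σ t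
    rw [Category.assoc, hg, hτ]

/-- The morphism `X₁ ⟶ X₀ ×_S X_{0ς}` with components `π₁` and `π₂(σ)`. -/
noncomputable def corr (X : TwistedDiagram.{u} ς) (s : X.Idx) :
    X.X₁ ⟶ pullback X.str₀ X.twistStr :=
  pullback.lift X.π₁ (X.π₂ s) (by rw [X.π₁_str, X.π₂_twistStr])

/-- The product `P₀ ×_S P' ⟶ X₀ ×_S X_{0ς}` of two morphisms `P₀ ⟶ X₀` and `P' ⟶ X_{0ς}`. -/
noncomputable def prodMap (X : TwistedDiagram.{u} ς) {P₀ P' : Scheme.{u}} (a : P₀ ⟶ X.X₀)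
    (a' : P' ⟶ X.twist) :
    pullback (a ≫ X.str₀) (a' ≫ X.twistStr) ⟶ pullback X.str₀ X.twistStr :=
  pullback.lift (pullback.fst _ _ ≫ a) (pullback.snd _ _ ≫ a')
    (by simpa only [Category.assoc] using pullback.condition)

/-- The fibre product `(P₀ ×_S P') ×_{X₀ ×_S X_{0ς}} X₁`. -/
noncomputable def fibreProd (X : TwistedDiagram.{u} ς) (s : X.Idx) {P₀ P' : Scheme.{u}}
    (a : P₀ ⟶ X.X₀) (a' : P' ⟶ X.twist) : Scheme.{u} :=
  pullback (X.prodMap a a') (X.corr s)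

/-- The projection of the fibre product to `P₀`. -/
noncomputable def fibreProdFst (X : TwistedDiagram.{u} ς) (s : X.Idx) {P₀ P' : Scheme.{u}}
    (a : P₀ ⟶ X.X₀) (a' : P' ⟶ X.twist) : X.fibreProd s a a' ⟶ P₀ :=
  pullback.fst (X.prodMap a a') (X.corr s) ≫ pullback.fst _ _

/-- The projection of the fibre product to `P'`. -/
noncomputable def fibreProdSnd (X : TwistedDiagram.{u} ς) (s : X.Idx) {P₀ P' : Scheme.{u}}
    (a : P₀ ⟶ X.X₀) (a' : P' ⟶ X.twist) : X.fibreProd s a a' ⟶ P' :=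
  pullback.fst (X.prodMap a a') (X.corr s) ≫ pullback.snd _ _

/-- The projection of the fibre product to `X₁`. -/
noncomputable def fibreProdBase (X : TwistedDiagram.{u} ς) (s : X.Idx) {P₀ P' : Scheme.{u}}
    (a : P₀ ⟶ X.X₀) (a' : P' ⟶ X.twist) : X.fibreProd s a a' ⟶ X.X₁ :=
  pullback.snd (X.prodMap a a') (X.corr s)

lemma fibreProd_fst_comm (X : TwistedDiagram.{u} ς) (s : X.Idx) {P₀ P' : Scheme.{u}}
    (a : P₀ ⟶ X.X₀) (a' : P' ⟶ X.twist) :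
    X.fibreProdFst s a a' ≫ a = X.fibreProdBase s a a' ≫ X.π₁ := by
  have h := congrArg (· ≫ pullback.fst X.str₀ X.twistStr)
    (pullback.condition (f := X.prodMap a a') (g := X.corr s))
  simp only [prodMap, corr, Category.assoc, pullback.lift_fst] at h
  exact (Category.assoc _ _ _).trans h

lemma fibreProd_snd_comm (X : TwistedDiagram.{u} ς) (s : X.Idx) {P₀ P' : Scheme.{u}}
    (a : P₀ ⟶ X.X₀) (a' : P' ⟶ X.twist) :
    X.fibreProdSnd s a a' ≫ a' = X.fibreProdBase s a a' ≫ X.π₂ s := by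
  have h := congrArg (· ≫ pullback.snd X.str₀ X.twistStr)
    (pullback.condition (f := X.prodMap a a') (g := X.corr s))
  simp only [prodMap, corr, Category.assoc, pullback.lift_snd] at h
  exact (Category.assoc _ _ _).trans h

/-- The morphism of fibre products
`(P₀ ×_S P') ×_{X₀ ×_S X_{0ς}} X₁ ⟶ (P₀ ×_S P') ×_{Y₀ ×_S Y_{0ς}} Y₁` induced by the identities
of `P₀` and `P'` and by `f₁`. -/
noncomputable def fibreProdMap {X Y : TwistedDiagram.{u} ς} (f : X ⟶ Y) (s : X.Idx)
    {P₀ P' : Scheme.{u}} (a : P₀ ⟶ X.X₀) (a' : P' ⟶ X.twist) :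
    X.fibreProd s a a' ⟶ Y.fibreProd (f.idx s) (a ≫ f.f₀) (a' ≫ Hom.twist f) :=
  pullback.lift
    (pullback.lift (X.fibreProdFst s a a') (X.fibreProdSnd s a a') (by
      simp only [Category.assoc, f.f₀_str, Hom.twist_twistStr]
      rw [← Category.assoc, fibreProd_fst_comm, ← Category.assoc, fibreProd_snd_comm,
        Category.assoc, Category.assoc, X.π₁_str, X.π₂_twistStr]))
    (X.fibreProdBase s a a' ≫ f.f₁) (by
      apply pullback.hom_ext
      · simp only [prodMap, corr, Category.assoc, pullback.lift_fst, pullback.lift_fst_assoc]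
        rw [← Category.assoc, fibreProd_fst_comm, Category.assoc, f.π₁_comm]
      · simp only [prodMap, corr, Category.assoc, pullback.lift_snd, pullback.lift_snd_assoc]
        rw [← Category.assoc, fibreProd_snd_comm, Category.assoc, Hom.π₂_comm])

/-- The object `(P₀, U, G₀ τ)` attached to an open subscheme `U` of the fibre product
`(P₀ ×_S P') ×_{Y₀ ×_S Y_{0ς}} Y₁` and a morphism `c : P' ⟶ P₀` over `Y_{0ς} ⟶ Y₀`. Its first
morphism is the projection `U ⟶ P₀`, its twisted morphisms are the composites of
`τ : U ⟶ P' ⟶ P₀` with the elements of `G₀ = Aut (P₀/Y₀)`. -/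
noncomputable def closureObj (Y : TwistedDiagram.{u} ς) (t : Y.Idx) {P₀ P' : Scheme.{u}}
    (a : P₀ ⟶ Y.X₀) (a' : P' ⟶ Y.twist) (c : P' ⟶ P₀) (hc : c ≫ a = a' ≫ Y.twistProj)
    (U : (Y.fibreProd t a a').Opens) : TwistedDiagram.{u} ς :=
  Y.orbitObj t a (U.ι ≫ Y.fibreProdBase t a a') (U.ι ≫ Y.fibreProdFst t a a')
    (U.ι ≫ Y.fibreProdSnd t a a' ≫ c)
    (by rw [Category.assoc, fibreProd_fst_comm, Category.assoc])
    (by rw [Category.assoc, Category.assoc, hc, ← Category.assoc (Y.fibreProdSnd t a a'),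
          fibreProd_snd_comm, Category.assoc, Category.assoc, π₂_twistProj])

/-- The projection of `closureObj` to `Y`. -/
noncomputable def closureMap (Y : TwistedDiagram.{u} ς) (t : Y.Idx) {P₀ P' : Scheme.{u}}
    (a : P₀ ⟶ Y.X₀) (a' : P' ⟶ Y.twist) (c : P' ⟶ P₀) (hc : c ≫ a = a' ≫ Y.twistProj)
    (U : (Y.fibreProd t a a').Opens) : Y.closureObj t a a' c hc U ⟶ Y :=
  Y.orbitMap t _ _ _ _ _ _

lemma comparison_comp {X Y : TwistedDiagram.{u} ς} (f : X ⟶ Y) {P₀ P' : Scheme.{u}}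
    {a : P₀ ⟶ X.X₀} {a' : P' ⟶ X.twist} {c : P' ⟶ P₀} (hc : c ≫ a = a' ≫ X.twistProj) :
    c ≫ a ≫ f.f₀ = (a' ≫ Hom.twist f) ≫ Y.twistProj := by
  rw [← Category.assoc, hc, Category.assoc, Category.assoc, Hom.twist_twistProj]

end TwistedDiagram

/-!
Let `f : X ⟶ Y` be finite étale with `X` and `Y` connected. In the power of `X` over `Y` indexed by
the points of a geometric fibre of `f`, take the component of the tautological point. It splits `f`,
and a connected `Y`-scheme which splits `f` maps to it, with a prescribed value at one geometric
point: the sections through the corresponding points of the base change of `X` are the coordinates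
of such a map. Hence this component is the Galois closure of `f`. Splitting is preserved by base
change, so `P' ⟶ Y_{0ς} ⟶ Y₀` splits `f₀` as `P' ⟶ Y_{0ς}` splits `f_{0ς}`; this gives the morphism
`c : P' ⟶ P₀`.

A pair of automorphisms of `P₀` and `P'` induces an automorphism of the fibre product over `Y₁`, and
such pairs act transitively on its geometric fibres. Those which move a point of a component to
another point of it preserve the component, which is therefore a Galois cover. Finally, the
morphisms `U ⟶ P₀` over a given `U ⟶ Y₀` with `U` connected are simply transitively permuted by
`Aut (P₀/Y₀)`. For a lift `τ` of `π₁` or `σ` and an automorphism `g` of the component, `τ g` is a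
second such morphism, so it is `g^τ τ` for a unique `g^τ`, and `g ↦ g^τ` is a homomorphism.
-/

section Reduced

open TensorProduct

lemma eq_zero_of_forall_one_tmul_residueField_eq_zero {A M : Type*} [CommRing A] [IsReduced A]
    [AddCommGroup M] [Module A M] [Module.Projective A M] (x : M)
    (hx : ∀ (q : Ideal A) [q.IsPrime], (1 : q.ResidueField) ⊗ₜ[A] x = 0) : x = 0 := by
  rw [← Module.forall_dual_apply_eq_zero_iff A]
  intro φ
  refine (nilpotent_iff_mem_prime.2 fun q hq => ?_).eq_zero
  have h : φ.baseChange q.ResidueField (1 ⊗ₜ x) = 0 := by rw [hx q, map_zero]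
  rwa [Module.Dual.baseChange_apply_tmul, ← Algebra.algebraMap_eq_smul_one,
    Ideal.algebraMap_residueField_eq_zero] at h

lemma isReduced_of_finite_of_etale (A B : Type*) [CommRing A] [IsReduced A] [CommRing B]
    [Algebra A B] [Module.Finite A B] [Algebra.Etale A B] : IsReduced B := by
  have := Module.FinitePresentation.of_finite_of_finitePresentation A B
  have : Module.Projective A B := Module.Flat.projective_of_finitePresentation
  refine ⟨fun b hb => eq_zero_of_forall_one_tmul_residueField_eq_zero (A := A) b fun q _ => ?_⟩
  have : IsReduced (q.ResidueField ⊗[A] B) :=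
    Algebra.FormallyUnramified.isReduced_of_field q.ResidueField _
  exact (hb.map (Algebra.TensorProduct.includeRight : B →ₐ[A] q.ResidueField ⊗[A] B)).eq_zero

end Reduced

section FiniteEtale

variable {X Y Z : Scheme.{u}}

namespace finiteEtale

instance : MorphismProperty.IsMultiplicative finiteEtale where
  id_mem _ := ⟨inferInstance, inferInstance⟩
  comp_mem _ _ := fun ⟨_, _⟩ ⟨_, _⟩ => ⟨inferInstance, inferInstance⟩

instance : MorphismProperty.IsStableUnderBaseChange finiteEtale where
  of_isPullback sq := fun ⟨h, h'⟩ =>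
    ⟨MorphismProperty.of_isPullback sq h, MorphismProperty.of_isPullback sq h'⟩

instance : MorphismProperty.HasOfPostcompProperty finiteEtale finiteEtale where
  of_postcomp f g := fun ⟨_, _⟩ ⟨_, _⟩ => ⟨IsFinite.of_comp f g, Etale.of_comp f g⟩

lemma isReduced_of_isAffine {p : X ⟶ Y} (hp : finiteEtale p) [IsAffine Y] [IsReduced Y] :
    IsReduced X := by
  obtain ⟨_, h⟩ := hp
  have : IsAffine X := isAffine_of_isAffineHom p
  have hfin : p.appTop.hom.Finite := p.finite_appTop
  have het : p.appTop.hom.Etale := HasRingHomProperty.appTop _ p h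
  algebraize [p.appTop.hom]
  have := isReduced_of_finite_of_etale Γ(Y, ⊤) Γ(X, ⊤)
  exact isReduced_of_isAffine_isReduced X

lemma isReduced {p : X ⟶ Y} (hp : finiteEtale p) [IsReduced Y] : IsReduced X := by
  have (i : Y.affineCover.I₀) : IsReduced ((Y.affineCover.pullback₁ p).X i) :=
    have : IsReduced (Y.affineCover.X i) := isReduced_of_isOpenImmersion (Y.affineCover.f i)
    isReduced_of_isAffine (p := pullback.snd p (Y.affineCover.f i))
      (MorphismProperty.pullback_snd _ _ hp)
  exact @IsReduced.of_openCover _ (Y.affineCover.pullback₁ p) this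

lemma surjective {p : X ⟶ Y} (hp : finiteEtale p) [Nonempty X] [ConnectedSpace Y] :
    Surjective p := by
  obtain ⟨_, _⟩ := hp
  exact ⟨Set.range_eq_univ.1 (IsClopen.eq_univ
    ⟨p.isClosedMap.isClosed_range, p.isOpenMap.isOpen_range⟩ (Set.range_nonempty _))⟩

lemma isOpen_connectedComponent {p : X ⟶ Y} (hp : finiteEtale p) [ConnectedSpace Y] (x : X) :
    IsOpen (connectedComponent x) := by
  obtain ⟨_, _⟩ := hp
  have := p.isOpenMap.finite_connectedComponents_of_finite_preimage_singleton_of_connectedSpace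
    p.isClosedMap (p.finite_preimage_singleton (p x))
  rw [← connectedComponents_preimage_singleton]
  exact (isOpen_discrete _).preimage ConnectedComponents.continuous_coe

end finiteEtale

lemma IsAlgebraicVariety.comp_of_finiteEtale {s : Y ⟶ Z} (hs : IsAlgebraicVariety s) {p : X ⟶ Y}
    (hp : finiteEtale p) : IsAlgebraicVariety (p ≫ s) := by
  obtain ⟨_, _, _, _⟩ := hs
  have ⟨_, _⟩ := hp
  exact ⟨hp.isReduced, inferInstance, inferInstance, inferInstance⟩

end FiniteEtale

section GeometricPoints

variable {X Y : Scheme.{u}}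

lemma exists_geometricPoint (X : Scheme.{u}) [Nonempty X] :
    ∃ (Ω : Type u) (_ : Field Ω) (_ : IsAlgClosed Ω), Nonempty (Spec (.of Ω) ⟶ X) := by
  obtain ⟨x⟩ := ‹Nonempty X›
  exact ⟨AlgebraicClosure (X.residueField x), inferInstance, inferInstance,
    ⟨Spec.map (CommRingCat.ofHom (algebraMap (X.residueField x) _)) ≫ X.fromSpecResidueField x⟩⟩

variable {Ω : Type u} [Field Ω] [IsAlgClosed Ω]

lemma exists_geometricPoint_comp_eq (p : X ⟶ Y) [LocallyOfFiniteType p] [QuasiCompact p]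
    [Surjective p] (y : Spec (.of Ω) ⟶ Y) : ∃ x : Spec (.of Ω) ⟶ X, x ≫ p = y := by
  let q := pullback.snd p y
  have : CompactSpace ↥(pullback p y) := QuasiCompact.compactSpace_of_compactSpace q
  have : Nonempty ↥(pullback p y) := ⟨(q.surjective (IsLocalRing.closedPoint Ω)).choose⟩
  obtain ⟨z, -, hz⟩ := (isClosed_univ (X := ↥(pullback p y))).exists_closed_singleton
    Set.univ_nonempty
  exact ⟨pointOfClosedPoint q z hz ≫ pullback.fst p y, by
    rw [Category.assoc, pullback.condition, pointOfClosedPoint_comp_assoc]⟩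

lemma finite_geometricPoint_comp_eq (p : X ⟶ Y) [IsFinite p] (y : Spec (.of Ω) ⟶ Y) :
    Finite {x : Spec (.of Ω) ⟶ X // x ≫ p = y} := by
  let q := pullback.snd p y
  have : Finite ↥(pullback p y) := by
    simpa only [Set.preimage_univ, Set.finite_univ_iff] using q.finite_preimage Set.finite_univ
  have := Finite.of_equiv _ (pointEquivClosedPoint q).symm
  refine Finite.of_injective (β := {t : Spec (.of Ω) ⟶ pullback p y // t ≫ q = 𝟙 _})
    (fun x => ⟨pullback.lift x.1 (𝟙 _) (by simp [x.2]), pullback.lift_snd _ _ _⟩) fun x x' h => ?_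
  simpa [Subtype.ext_iff, pullback.lift_fst] using congrArg (fun t => t.1 ≫ pullback.fst p y) h

end GeometricPoints

lemma eq_of_comp_eq_of_preconnectedSpace {T U P X : Scheme.{u}} [PreconnectedSpace U] [Nonempty T]
    (p : P ⟶ X) [FormallyUnramified p] [LocallyOfFiniteType p] [IsSeparated p] {a b : U ⟶ P}
    (h : a ≫ p = b ≫ p) (x : T ⟶ U) (hx : x ≫ a = x ≫ b) : a = b := by
  let e := pullback.fst (pullback.lift a b h) (pullback.diagonal p)
  let v : T ⟶ pullback (pullback.lift a b h) (pullback.diagonal p) :=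
    pullback.lift x (x ≫ a) (by
      apply pullback.hom_ext <;> simp [hx, pullback.lift_fst, pullback.lift_snd])
  have : Surjective e := ⟨Set.range_eq_univ.1 (IsClopen.eq_univ
    ⟨e.isClosedEmbedding.isClosed_range, e.isOpenEmbedding.isOpen_range⟩
    ⟨_, v (Classical.arbitrary T), rfl⟩)⟩
  have : IsIso e := (isIso_iff_isOpenImmersion_and_surjective e).2 ⟨inferInstance, this⟩
  have he : e ≫ pullback.lift a b h = pullback.snd _ _ ≫ pullback.diagonal p := pullback.condition
  rw [← cancel_epi e]
  calc e ≫ a = e ≫ pullback.lift a b h ≫ pullback.fst p p := by rw [pullback.lift_fst]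
    _ = e ≫ pullback.lift a b h ≫ pullback.snd p p := by simp [reassoc_of% he]
    _ = e ≫ b := by rw [pullback.lift_snd]

section Components

variable {T W Y Z : Scheme.{u}} {U : W.Opens}

namespace IsComponent

lemma connectedSpace (hU : IsComponent U) : ConnectedSpace U := by
  obtain ⟨x, hx⟩ := hU
  exact Subtype.connectedSpace (s := (U : Set W)) (hx ▸ isConnected_connectedComponent)

lemma finiteEtale_ι (hU : IsComponent U) : finiteEtale U.ι := by
  obtain ⟨x, hx⟩ := hU
  have hc : IsClosed (Set.range U.ι) := by
    rw [Scheme.Opens.range_ι, hx]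
    exact isClosed_connectedComponent
  have : IsClosedImmersion U.ι := .of_isPreimmersion _ hc
  exact ⟨inferInstance, inferInstance⟩

lemma exists_lift (hU : IsComponent U) [PreconnectedSpace Z] (v : Z ⟶ W) {z : Z} (hz : v z ∈ U) :
    ∃ γ : Z ⟶ U, γ ≫ U.ι = v := by
  obtain ⟨x, hx⟩ := hU
  have hz' : v z ∈ connectedComponent x := hx ▸ hz
  have hv : Set.range v ⊆ Set.range U.ι := by
    rw [Scheme.Opens.range_ι, hx, connectedComponent_eq hz']
    exact (isPreconnected_range v.continuous).subset_connectedComponent ⟨z, rfl⟩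
  exact ⟨IsOpenImmersion.lift U.ι v hv, IsOpenImmersion.lift_fac _ _ _⟩

lemma exists_lift_of_comp_eq (hU : IsComponent U) [PreconnectedSpace Z] [Nonempty T] (v : Z ⟶ W)
    (z : T ⟶ Z) (u : T ⟶ U) (h : z ≫ v = u ≫ U.ι) : ∃ γ : Z ⟶ U, γ ≫ U.ι = v ∧ z ≫ γ = u := by
  obtain ⟨t⟩ := ‹Nonempty T›
  obtain ⟨γ, hγ⟩ := hU.exists_lift v (z := z t) (by
    rw [← Scheme.Hom.comp_apply, h]
    exact (u t).2)
  exact ⟨γ, hγ, by rw [← cancel_mono U.ι, Category.assoc, hγ, h]⟩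

end IsComponent

lemma finiteEtale.exists_isComponent {p : W ⟶ Y} (hp : finiteEtale p) [ConnectedSpace Y]
    [ConnectedSpace Z] (w : Z ⟶ W) :
    ∃ U : W.Opens, IsComponent U ∧ ∃ u : Z ⟶ U, u ≫ U.ι = w := by
  let x := w (Classical.arbitrary Z)
  have hU : IsComponent ⟨connectedComponent x, hp.isOpen_connectedComponent x⟩ := ⟨x, rfl⟩
  exact ⟨_, hU, hU.exists_lift w mem_connectedComponent⟩

lemma IsComponent.exists_le_preimage {V : Z.Opens} (hV : IsComponent V) (φ : Z ⟶ W) {p : W ⟶ Y}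
    (hp : finiteEtale p) [ConnectedSpace Y] : ∃ U : W.Opens, IsComponent U ∧ V ≤ φ ⁻¹ᵁ U := by
  have := hV.connectedSpace
  obtain ⟨U, hU, u, hu⟩ := hp.exists_isComponent (V.ι ≫ φ)
  refine ⟨U, hU, fun z hz => ?_⟩
  change (V.ι ≫ φ) (⟨z, hz⟩ : V) ∈ U
  rw [← hu]
  exact (u _).2

end Components

section Galois

variable {P X Y U W Z : Scheme.{u}}

lemma aut_hom_left_comp {p : P ⟶ X} (g : Aut (Over.mk p)) : g.hom.left ≫ p = p := Over.w g.hom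

namespace IsGaloisCover

-- By rigidity, endomorphisms which send `x` to `x'` and `x'` to `x` are inverse to each other.
lemma of_exists_endomorphism {p : P ⟶ Y} (hp : _root_.finiteEtale p) [ConnectedSpace P]
    [ConnectedSpace Y]
    (h : ∀ (Ω : Type u) [Field Ω] [IsAlgClosed Ω] (x x' : Spec (.of Ω) ⟶ P),
      x ≫ p = x' ≫ p → ∃ g : P ⟶ P, g ≫ p = p ∧ x ≫ g = x') :
    IsGaloisCover p := by
  refine ⟨hp, hp.surjective, inferInstance, fun Ω _ _ x x' hx => ?_⟩
  obtain ⟨_, _⟩ := hp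
  obtain ⟨g, hgp, hg⟩ := h Ω x x' hx
  obtain ⟨g', hgp', hg'⟩ := h Ω x' x hx.symm
  have hgg' : g ≫ g' = 𝟙 P := eq_of_comp_eq_of_preconnectedSpace p
    (by rw [Category.assoc, hgp', hgp, Category.id_comp]) x
    (by rw [reassoc_of% hg, hg', Category.comp_id])
  have hg'g : g' ≫ g = 𝟙 P := eq_of_comp_eq_of_preconnectedSpace p
    (by rw [Category.assoc, hgp, hgp', Category.id_comp]) x'
    (by rw [reassoc_of% hg', hg, Category.comp_id])
  exact ⟨Over.isoMk ⟨g, g', hgg', hg'g⟩ hgp, hg⟩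

lemma of_comp {q : P ⟶ X} {f : X ⟶ Y} (h : IsGaloisCover (q ≫ f)) (hf : _root_.finiteEtale f)
    [ConnectedSpace X] : IsGaloisCover q := by
  have := h.connected
  refine of_exists_endomorphism (MorphismProperty.of_postcomp _ q f hf h.finiteEtale)
    fun Ω _ _ x x' hx => ?_
  obtain ⟨_, _⟩ := hf
  obtain ⟨g, hg⟩ := h.transitive Ω x x' (by rw [reassoc_of% hx])
  refine ⟨g.hom.left, eq_of_comp_eq_of_preconnectedSpace f ?_ x ?_, hg⟩
  · rw [Category.assoc, aut_hom_left_comp]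
  · rw [reassoc_of% hg, hx]

lemma existsUnique_comp_eq {p : P ⟶ X} (hp : IsGaloisCover p) [ConnectedSpace U] (a b : U ⟶ P)
    (h : a ≫ p = b ≫ p) : ∃! g : Aut (Over.mk p), a ≫ g.hom.left = b := by
  obtain ⟨⟨_, _⟩, _, _, htr⟩ := hp
  obtain ⟨Ω, _, _, ⟨x⟩⟩ := exists_geometricPoint U
  obtain ⟨g, hg⟩ := htr Ω (x ≫ a) (x ≫ b) (by simp only [Category.assoc, h])
  refine ⟨g, ?_, fun g' hg' => ?_⟩
  · refine eq_of_comp_eq_of_preconnectedSpace p ?_ x (by rw [← Category.assoc, hg])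
    rw [Category.assoc, aut_hom_left_comp, h]
  · apply Aut.ext
    ext1
    refine eq_of_comp_eq_of_preconnectedSpace (U := P) (P := P) p ?_ (x ≫ a) ?_
    · rw [aut_hom_left_comp, aut_hom_left_comp]
    · rw [hg, Category.assoc, hg']

lemma exists_monoidHom {p : P ⟶ X} (hp : IsGaloisCover p) [ConnectedSpace Z] (q : Z ⟶ W)
    (τ : Z ⟶ P) (ρ : W ⟶ X) (hτ : τ ≫ p = q ≫ ρ) :
    ∃ φ : Aut (Over.mk q) →* Aut (Over.mk p), ∀ g, g.hom.left ≫ τ = τ ≫ (φ g).hom.left := by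
  have htranslate (g : Aut (Over.mk q)) := hp.existsUnique_comp_eq τ (g.hom.left ≫ τ) (by
    rw [Category.assoc, hτ, reassoc_of% aut_hom_left_comp g])
  choose φ hφ hφ' using htranslate
  refine ⟨MonoidHom.mk' φ fun g h => (hφ' _ _ ?_).symm, fun g => (hφ g).symm⟩
  calc τ ≫ (φ h).hom.left ≫ (φ g).hom.left = h.hom.left ≫ τ ≫ (φ g).hom.left := by
        rw [reassoc_of% hφ h]
    _ = (h.hom.left ≫ g.hom.left) ≫ τ := by rw [hφ g, Category.assoc]

end IsGaloisCover

lemma IsComponent.isGaloisCover {U : W.Opens} (hU : IsComponent U) {p : W ⟶ Y}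
    (hp : finiteEtale p) [ConnectedSpace Y]
    (h : ∀ (Ω : Type u) [Field Ω] [IsAlgClosed Ω] (x x' : Spec (.of Ω) ⟶ U),
      x ≫ U.ι ≫ p = x' ≫ U.ι ≫ p → ∃ g : W ⟶ W, g ≫ p = p ∧ x ≫ U.ι ≫ g = x' ≫ U.ι) :
    IsGaloisCover (U.ι ≫ p) := by
  have := hU.connectedSpace
  refine .of_exists_endomorphism (MorphismProperty.comp_mem _ _ _ hU.finiteEtale_ι hp)
    fun Ω _ _ x x' hx => ?_
  obtain ⟨g, hgp, hg⟩ := h Ω x x' hx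
  obtain ⟨γ, hγ, hγx⟩ := hU.exists_lift_of_comp_eq (U.ι ≫ g) x x' hg
  exact ⟨γ, by rw [reassoc_of% hγ, hgp], hγx⟩

end Galois

section FibrePower

variable {X Y : Scheme.{u}}

lemma finiteEtale.exists_fibrePower {f : X ⟶ Y} (hf : finiteEtale f) (ι : Type*) [Finite ι] :
    ∃ (W : Scheme.{u}) (π : W ⟶ Y) (p : ι → (W ⟶ X)), finiteEtale π ∧ (∀ i, p i ≫ f = π) ∧
      ∀ {Z : Scheme.{u}} (t : Z ⟶ Y) (a : ι → (Z ⟶ X)), (∀ i, a i ≫ f = t) →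
        ∃! v : Z ⟶ W, v ≫ π = t ∧ ∀ i, v ≫ p i = a i := by
  let F (_ : ι) := MorphismProperty.Over.mk ⊤ f hf
  have hlim := isLimitOfHasProductOfPreservesLimit (MorphismProperty.Over.forget _ ⊤ Y) F
  refine ⟨(∏ᶜ F).left, (∏ᶜ F).hom, fun i => (Pi.π F i).left, (∏ᶜ F).prop,
    fun i => Over.w (Pi.π F i).toCommaMorphism, fun t a ha => ?_⟩
  let v := Fan.IsLimit.lift hlim (A := Over.mk t) fun i => Over.homMk (a i) (ha i)
  have hv (i : ι) : v ≫ (Pi.π F i).toCommaMorphism = Over.homMk (a i) (ha i) :=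
    Fan.IsLimit.fac hlim _ i
  refine ⟨v.left, ⟨Over.w v, fun i => congrArg (·.left) (hv i)⟩, ?_⟩
  rintro v' ⟨hv', hv'p⟩
  refine congrArg (·.left) (Fan.IsLimit.hom_ext hlim (Over.homMk v' hv') v fun i => ?_)
  ext1
  exact (hv'p i).trans (congrArg (·.left) (hv i)).symm

end FibrePower

section Splitting

variable {P X Y Z : Scheme.{u}}

/-- `t : Z ⟶ Y` splits `f : X ⟶ Y` if every geometric point of the base change `Z ×_Y X` lies on a
section of it over `Z`. Sections are encoded as morphisms `Z ⟶ X` over `Y`. -/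
def Splits (t : Z ⟶ Y) (f : X ⟶ Y) : Prop :=
  ∀ (Ω : Type u) [Field Ω] [IsAlgClosed Ω] (z : Spec (.of Ω) ⟶ Z) (x : Spec (.of Ω) ⟶ X),
    x ≫ f = z ≫ t → ∃ s : Z ⟶ X, s ≫ f = t ∧ z ≫ s = x

lemma Splits.of_isPullback {X' Y' : Scheme.{u}} {g' : X' ⟶ X} {f' : X' ⟶ Y'} {f : X ⟶ Y}
    {g : Y' ⟶ Y} (sq : IsPullback g' f' f g) {t : Z ⟶ Y'} (ht : Splits t f') :
    Splits (t ≫ g) f := by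
  intro Ω _ _ z x hx
  obtain ⟨s, hs, hzs⟩ := ht Ω z (sq.lift x (z ≫ t) (by rw [hx, Category.assoc]))
    (sq.lift_snd _ _ _)
  exact ⟨s ≫ g', by rw [Category.assoc, sq.w, reassoc_of% hs],
    by rw [reassoc_of% hzs, sq.lift_fst]⟩

lemma IsGaloisCover.splits {q : Z ⟶ X} {f : X ⟶ Y} (h : IsGaloisCover (q ≫ f))
    (hf : _root_.finiteEtale f) [ConnectedSpace X] : Splits (q ≫ f) f := by
  intro Ω _ _ z x hx
  have ⟨⟨_, _⟩, _, _, _⟩ := h.of_comp hf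
  obtain ⟨z', rfl⟩ := exists_geometricPoint_comp_eq q x
  obtain ⟨g, hg⟩ := h.transitive Ω z z' (by rw [← hx, Category.assoc])
  exact ⟨g.hom.left ≫ q, by rw [Category.assoc, aut_hom_left_comp], by rw [reassoc_of% hg]⟩

-- Let `C` be the component of `X ×_Y P` through `(x, z)`. As `C` surjects onto `P`, it has a point
-- over `u`; the section through that point maps `P` isomorphically onto `C`, so it meets `x`.
lemma splits_of_geometricPoint {f : X ⟶ Y} (hf : finiteEtale f) {π : P ⟶ Y} [ConnectedSpace P]
    {Ω : Type u} [Field Ω] [IsAlgClosed Ω] (u : Spec (.of Ω) ⟶ P)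
    (hu : ∀ x : Spec (.of Ω) ⟶ X, x ≫ f = u ≫ π → ∃ s : P ⟶ X, s ≫ f = π ∧ u ≫ s = x) :
    Splits π f := by
  intro K _ _ z x hx
  have hsnd : finiteEtale (pullback.snd f π) := MorphismProperty.pullback_snd _ _ hf
  obtain ⟨C, hC, c, hc⟩ := hsnd.exists_isComponent (pullback.lift x z hx)
  have := hC.connectedSpace
  let r : C.toScheme ⟶ P := C.ι ≫ pullback.snd f π
  have hr : finiteEtale r := MorphismProperty.comp_mem _ _ _ hC.finiteEtale_ι hsnd
  have := hr.surjective
  obtain ⟨_, _⟩ := hr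
  obtain ⟨v, hv⟩ := exists_geometricPoint_comp_eq r u
  obtain ⟨s, hs, hus⟩ := hu (v ≫ C.ι ≫ pullback.fst f π) (by
    rw [← hv, Category.assoc, Category.assoc, Category.assoc, pullback.condition, Category.assoc])
  obtain ⟨σ, hσ, -⟩ := hC.exists_lift_of_comp_eq
    (pullback.lift s (𝟙 P) (by rw [hs, Category.id_comp])) u v (by
      apply pullback.hom_ext
      · rw [Category.assoc, pullback.lift_fst, hus, Category.assoc]
      · rw [Category.assoc, pullback.lift_snd, Category.comp_id, Category.assoc]
        exact hv.symm)
  have hσr : σ ≫ r = 𝟙 P := by rw [reassoc_of% hσ, pullback.lift_snd]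
  have hrσ : r ≫ σ = 𝟙 _ := eq_of_comp_eq_of_preconnectedSpace r
    (by rw [Category.assoc, hσr, Category.comp_id, Category.id_comp]) σ
    (by rw [reassoc_of% hσr, Category.comp_id])
  refine ⟨s, hs, ?_⟩
  have hcr : c ≫ r = z := by rw [reassoc_of% hc, pullback.lift_snd]
  calc z ≫ s = c ≫ r ≫ σ ≫ C.ι ≫ pullback.fst f π := by
        rw [reassoc_of% hσ, pullback.lift_fst, reassoc_of% hcr]
    _ = x := by rw [reassoc_of% hrσ, reassoc_of% hc, pullback.lift_fst]

/-- The connected finite étale cover `π : P ⟶ Y` splits `f` and is universal among the connected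
`Y`-schemes which do so; given such a `t : Z ⟶ Y`, the factorization through `P` may even be
prescribed at a geometric point. It serves to construct the Galois closure of `f`. -/
structure IsUniversalSplitting (π : P ⟶ Y) (f : X ⟶ Y) : Prop where
  finiteEtale : finiteEtale π
  connected : ConnectedSpace P
  splits : Splits π f
  exists_lift : ∀ {Z : Scheme.{u}} [ConnectedSpace Z] (t : Z ⟶ Y), Splits t f →
    ∀ (Ω : Type u) [Field Ω] [IsAlgClosed Ω] (z : Spec (.of Ω) ⟶ Z) (z' : Spec (.of Ω) ⟶ P),
      z ≫ t = z' ≫ π → ∃ v : Z ⟶ P, v ≫ π = t ∧ z ≫ v = z'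

lemma finiteEtale.exists_isUniversalSplitting {f : X ⟶ Y} (hf : finiteEtale f) [Nonempty X]
    [ConnectedSpace Y] : ∃ (P : Scheme.{u}) (q : P ⟶ X), IsUniversalSplitting (q ≫ f) f := by
  have ⟨_, _⟩ := hf
  obtain ⟨Ω, _, _, ⟨x₀⟩⟩ := exists_geometricPoint X
  let ι := {x : Spec (.of Ω) ⟶ X // x ≫ f = x₀ ≫ f}
  have : Finite ι := finite_geometricPoint_comp_eq f (x₀ ≫ f)
  obtain ⟨W, π, p, hπ, hp, huniv⟩ := hf.exists_fibrePower ι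
  obtain ⟨w, ⟨hwπ, hwp⟩, -⟩ := huniv (x₀ ≫ f) (fun i => i.1) fun i => i.2
  obtain ⟨U, hU, u, hu⟩ := hπ.exists_isComponent w
  have hUπ : (U.ι ≫ p ⟨x₀, rfl⟩) ≫ f = U.ι ≫ π := by rw [Category.assoc, hp]
  refine ⟨U, U.ι ≫ p ⟨x₀, rfl⟩, ?_⟩
  rw [hUπ]
  have := hU.connectedSpace
  refine ⟨MorphismProperty.comp_mem _ _ _ hU.finiteEtale_ι hπ, this, ?_, ?_⟩
  · refine splits_of_geometricPoint hf u fun x hx => ?_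
    rw [reassoc_of% hu, hwπ] at hx
    exact ⟨U.ι ≫ p ⟨x, hx⟩, by rw [Category.assoc, hp], by rw [reassoc_of% hu, hwp]⟩
  · intro Z _ t ht K _ _ z z' hz
    choose a hat hza using fun i => ht K z (z' ≫ U.ι ≫ p i) (by simp only [Category.assoc, hp, hz])
    obtain ⟨v, ⟨hvt, hva⟩, -⟩ := huniv t a hat
    have hzv : z ≫ v = z' ≫ U.ι :=
      (huniv (z ≫ t) (fun i => z ≫ a i) fun i => by rw [Category.assoc, hat]).unique
        ⟨by rw [Category.assoc, hvt], fun i => by rw [Category.assoc, hva]⟩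
        ⟨by rw [Category.assoc, hz], fun i => by rw [Category.assoc, hza]⟩
    obtain ⟨γ, hγ, hzγ⟩ := hU.exists_lift_of_comp_eq v z z' hzv
    exact ⟨γ, by rw [reassoc_of% hγ, hvt], hzγ⟩

namespace IsUniversalSplitting

lemma isGaloisCover {π : P ⟶ Y} {f : X ⟶ Y} (h : IsUniversalSplitting π f) [ConnectedSpace Y] :
    IsGaloisCover π :=
  have := h.connected
  .of_exists_endomorphism h.finiteEtale (h.exists_lift π h.splits)

lemma exists_comp_eq_of_splits {q : P ⟶ X} {f : X ⟶ Y} (h : IsUniversalSplitting (q ≫ f) f)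
    (hf : _root_.finiteEtale f) [ConnectedSpace X] [ConnectedSpace Z] {r : Z ⟶ X}
    (hr : Splits (r ≫ f) f) : ∃ v : Z ⟶ P, v ≫ q = r := by
  have := h.connected
  have hq : _root_.finiteEtale q := MorphismProperty.of_postcomp _ q f hf h.finiteEtale
  have := hq.surjective
  obtain ⟨_, _⟩ := hf
  obtain ⟨_, _⟩ := hq
  obtain ⟨Ω, _, _, ⟨z⟩⟩ := exists_geometricPoint Z
  obtain ⟨z', hz'⟩ := exists_geometricPoint_comp_eq q (z ≫ r)
  obtain ⟨v, hv, hzv⟩ := h.exists_lift (r ≫ f) hr Ω z z' (by simp only [reassoc_of% hz'])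
  exact ⟨v, eq_of_comp_eq_of_preconnectedSpace f (by rw [Category.assoc, hv]) z
    (by rw [reassoc_of% hzv, hz'])⟩

lemma isGaloisClosure {q : P ⟶ X} {f : X ⟶ Y} (h : IsUniversalSplitting (q ≫ f) f)
    (hf : _root_.finiteEtale f) [ConnectedSpace X] [ConnectedSpace Y] : IsGaloisClosure q f where
  isGaloisCover := h.isGaloisCover
  dominated _ hr :=
    have := hr.connected
    h.exists_comp_eq_of_splits hf (hr.splits hf)

end IsUniversalSplitting

lemma finiteEtale.exists_isGaloisClosure {f : X ⟶ Y} (hf : finiteEtale f) [ConnectedSpace X]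
    [ConnectedSpace Y] : ∃ (P : Scheme.{u}) (q : P ⟶ X), IsGaloisClosure q f := by
  obtain ⟨P, q, h⟩ := hf.exists_isUniversalSplitting
  exact ⟨P, q, h.isGaloisClosure hf⟩

lemma IsGaloisClosure.exists_comp_eq_of_splits {q : P ⟶ X} {f : X ⟶ Y} (hq : IsGaloisClosure q f)
    (hf : finiteEtale f) [ConnectedSpace X] [ConnectedSpace Y] [ConnectedSpace Z] {r : Z ⟶ X}
    (hr : Splits (r ≫ f) f) : ∃ c : Z ⟶ P, c ≫ q = r := by
  obtain ⟨P', q', h⟩ := hf.exists_isUniversalSplitting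
  obtain ⟨v, hv⟩ := h.exists_comp_eq_of_splits hf hr
  obtain ⟨w, hw⟩ := hq.dominated q' h.isGaloisCover
  exact ⟨v ≫ w, by rw [Category.assoc, hw, hv]⟩

end Splitting

namespace TwistedDiagram

variable {R : Type u} [CommRing R] {ς : R →+* R}

section FibreProd

variable (X : TwistedDiagram.{u} ς) (s : X.Idx) {P₀ P' Z : Scheme.{u}} {a : P₀ ⟶ X.X₀}
  {a' : P' ⟶ X.twist}

lemma fibreProd_hom_ext {v w : Z ⟶ X.fibreProd s a a'}
    (h₀ : v ≫ X.fibreProdFst s a a' = w ≫ X.fibreProdFst s a a')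
    (h' : v ≫ X.fibreProdSnd s a a' = w ≫ X.fibreProdSnd s a a')
    (h₁ : v ≫ X.fibreProdBase s a a' = w ≫ X.fibreProdBase s a a') : v = w := by
  refine pullback.hom_ext (pullback.hom_ext ?_ ?_) h₁
  · exact (Category.assoc _ _ _).trans (h₀.trans (Category.assoc _ _ _).symm)
  · exact (Category.assoc _ _ _).trans (h'.trans (Category.assoc _ _ _).symm)

lemma exists_fibreProd_lift (v₀ : Z ⟶ P₀) (v' : Z ⟶ P') (v₁ : Z ⟶ X.X₁)
    (h₀ : v₀ ≫ a = v₁ ≫ X.π₁) (h' : v' ≫ a' = v₁ ≫ X.π₂ s) :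
    ∃ v : Z ⟶ X.fibreProd s a a', v ≫ X.fibreProdFst s a a' = v₀ ∧
      v ≫ X.fibreProdSnd s a a' = v' ∧ v ≫ X.fibreProdBase s a a' = v₁ := by
  have hv : v₀ ≫ a ≫ X.str₀ = v' ≫ a' ≫ X.twistStr := by
    rw [reassoc_of% h₀, reassoc_of% h', X.π₁_str, X.π₂_twistStr]
  have hw : pullback.lift v₀ v' hv ≫ X.prodMap a a' = v₁ ≫ X.corr s := by
    apply pullback.hom_ext
    · simp only [prodMap, corr, Category.assoc, pullback.lift_fst, pullback.lift_fst_assoc, h₀]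
    · simp only [prodMap, corr, Category.assoc, pullback.lift_snd, pullback.lift_snd_assoc, h']
  exact ⟨pullback.lift (pullback.lift v₀ v' hv) v₁ hw,
    (pullback.lift_fst_assoc _ _ _ _).trans (pullback.lift_fst _ _ _),
    (pullback.lift_fst_assoc _ _ _ _).trans (pullback.lift_snd _ _ _), pullback.lift_snd _ _ _⟩

lemma fibreProdBase_mem (Q : MorphismProperty Scheme.{u}) [Q.IsStableUnderBaseChange]
    [Q.IsStableUnderComposition] (ha : Q a) (ha' : Q a') : Q (X.fibreProdBase s a a') :=
  MorphismProperty.pullback_snd _ _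
    (MorphismProperty.pullbackMap (P := Q) (f := a ≫ X.str₀) (g := a' ≫ X.twistStr) ha ha' rfl rfl)

lemma surjective_fibreProdBase (ha : Surjective a) (ha' : Surjective a') :
    Surjective (X.fibreProdBase s a a') :=
  have : MorphismProperty.IsStableUnderComposition (C := Scheme.{u}) @Surjective :=
    ⟨fun _ _ _ _ => inferInstance⟩
  X.fibreProdBase_mem s @Surjective ha ha'

lemma exists_isComponent_fibreProd [ConnectedSpace X.X₁] (ha : IsGaloisCover a)
    (ha' : IsGaloisCover a') : ∃ U : (X.fibreProd s a a').Opens, IsComponent U := by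
  have := X.surjective_fibreProdBase s ha.surjective ha'.surjective
  have : Nonempty (X.fibreProd s a a') := (X.fibreProdBase s a a').surjective.nonempty
  obtain ⟨Ω, _, _, ⟨x⟩⟩ := exists_geometricPoint (X.fibreProd s a a')
  obtain ⟨U, hU, -⟩ :=
    (X.fibreProdBase_mem s finiteEtale ha.finiteEtale ha'.finiteEtale).exists_isComponent x
  exact ⟨U, hU⟩

lemma isGaloisCover_fibreProd_component [ConnectedSpace X.X₁] (ha : IsGaloisCover a)
    (ha' : IsGaloisCover a') {U : (X.fibreProd s a a').Opens} (hU : IsComponent U) :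
    IsGaloisCover (U.ι ≫ X.fibreProdBase s a a') := by
  refine hU.isGaloisCover (X.fibreProdBase_mem s finiteEtale ha.finiteEtale ha'.finiteEtale)
    fun Ω _ _ x x' hx => ?_
  obtain ⟨g₀, hg₀⟩ := ha.transitive Ω (x ≫ U.ι ≫ X.fibreProdFst s a a')
    (x' ≫ U.ι ≫ X.fibreProdFst s a a') (by
      simp only [Category.assoc, fibreProd_fst_comm, reassoc_of% hx])
  obtain ⟨g', hg'⟩ := ha'.transitive Ω (x ≫ U.ι ≫ X.fibreProdSnd s a a')
    (x' ≫ U.ι ≫ X.fibreProdSnd s a a') (by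
      simp only [Category.assoc, fibreProd_snd_comm, reassoc_of% hx])
  obtain ⟨v, hv₀, hv', hv₁⟩ := X.exists_fibreProd_lift s (X.fibreProdFst s a a' ≫ g₀.hom.left)
    (X.fibreProdSnd s a a' ≫ g'.hom.left) (X.fibreProdBase s a a')
    (by rw [Category.assoc, aut_hom_left_comp, fibreProd_fst_comm])
    (by rw [Category.assoc, aut_hom_left_comp, fibreProd_snd_comm])
  refine ⟨v, hv₁, X.fibreProd_hom_ext s ?_ ?_ ?_⟩
  · simpa only [Category.assoc, hv₀] using hg₀
  · simpa only [Category.assoc, hv'] using hg'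
  · simpa only [Category.assoc, hv₁] using hx

end FibreProd

section Orbit

variable (Y : TwistedDiagram.{u} ς) (t : Y.Idx) {Z₀ Z₁ : Scheme.{u}} {p₀ : Z₀ ⟶ Y.X₀}
  {p₁ : Z₁ ⟶ Y.X₁} {ϖ τ : Z₁ ⟶ Z₀} (hϖ : ϖ ≫ p₀ = p₁ ≫ Y.π₁) (hτ : τ ≫ p₀ = p₁ ≫ Y.σ t)

/-- The action of `Aut (Z₀/Y₀)` by composition on the twisted morphisms of `orbitObj`. -/
@[reducible]
def orbitMulAction : MulAction (Aut (Over.mk p₀)) (Y.orbitObj t p₀ p₁ ϖ τ hϖ hτ).Idx where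
  smul g ρ := ⟨ρ.1 ≫ g.hom.left, by
    obtain ⟨ρ, h, rfl⟩ := ρ
    exact ⟨g * h, Category.assoc _ _ _⟩⟩
  one_smul ρ := Subtype.ext (Category.comp_id ρ.1)
  mul_smul g h ρ := Subtype.ext (Category.assoc ρ.1 h.hom.left g.hom.left).symm

lemma exists_orbit_smul_eq (ρ ρ' : (Y.orbitObj t p₀ p₁ ϖ τ hϖ hτ).Idx) :
    letI := Y.orbitMulAction t hϖ hτ
    ∃ g : Aut (Over.mk p₀), g • ρ = ρ' := by
  obtain ⟨_, g, rfl⟩ := ρ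
  obtain ⟨_, g', rfl⟩ := ρ'
  refine ⟨g' * g⁻¹, Subtype.ext ?_⟩
  change (τ ≫ g.hom.left) ≫ (g' * g⁻¹).hom.left = τ ≫ g'.hom.left
  have hg : g.hom.left ≫ (g' * g⁻¹).hom.left = g'.hom.left :=
    congrArg (fun h : Aut (Over.mk p₀) => h.hom.left) (inv_mul_cancel_right g' g)
  rw [Category.assoc, hg]

lemma isAlmostDirectGaloisCover_orbitMap [Subsingleton Y.Idx] (hY : Y.IsAlmostDirectPresentation)
    (h₀ : IsGaloisCover p₀) (h₁ : IsGaloisCover p₁) :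
    IsAlmostDirectGaloisCover (Y.orbitMap t p₀ p₁ ϖ τ hϖ hτ) where
  source := ⟨hY.variety₀.comp_of_finiteEtale h₀.finiteEtale,
    hY.variety₁.comp_of_finiteEtale h₁.finiteEtale⟩
  target := hY
  galois₀ := h₀
  galois₁ := h₁
  action := ⟨Y.orbitMulAction t hϖ hτ, fun _ _ => rfl,
    fun _ => ⟨⟨τ, 1, (Category.comp_id τ).symm⟩, Subsingleton.elim _ _⟩,
    fun ρ ρ' => ⟨fun _ => Y.exists_orbit_smul_eq t hϖ hτ ρ ρ', fun _ => rfl⟩⟩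
  hom_π₁ :=
    have := h₁.connected
    h₀.exists_monoidHom p₁ ϖ Y.π₁ hϖ
  hom_σ := by
    have := h₁.connected
    rintro ⟨ρ, g, rfl⟩
    have hτg : (τ ≫ g.hom.left) ≫ p₀ = p₁ ≫ Y.σ t := by rw [Category.assoc, aut_hom_left_comp, hτ]
    exact h₀.exists_monoidHom p₁ _ (Y.σ t) hτg

end Orbit

section OrbitHom

variable {X Y : TwistedDiagram.{u} ς} (f : X ⟶ Y) (s : X.Idx) {Z₀ Z₁ Z₁' : Scheme.{u}}
  {p₀ : Z₀ ⟶ X.X₀} {p₁ : Z₁ ⟶ X.X₁} {ϖ τ : Z₁ ⟶ Z₀} (hϖ : ϖ ≫ p₀ = p₁ ≫ X.π₁)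
  (hτ : τ ≫ p₀ = p₁ ≫ X.σ s) {p₁' : Z₁' ⟶ Y.X₁} {ϖ' τ' : Z₁' ⟶ Z₀}
  (hϖ' : ϖ' ≫ p₀ ≫ f.f₀ = p₁' ≫ Y.π₁) (hτ' : τ' ≫ p₀ ≫ f.f₀ = p₁' ≫ Y.σ (f.idx s))
  (r : Z₁ ⟶ Z₁') (hr : r ≫ p₁' = p₁ ≫ f.f₁) (hrϖ : r ≫ ϖ' = ϖ) (hrτ : r ≫ τ' = τ)

/-- The morphism `(Z₀, Z₁, Aut (Z₀/X₀) τ) ⟶ (Z₀, Z₁', Aut (Z₀/Y₀) τ')` over `f` which consists of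
the identity of `Z₀` and of `r`. On twisted morphisms it sends `τ g` to `τ' g`, for a chosen
representation of each element of the orbit of `τ`. -/
noncomputable def orbitHom : X.orbitObj s p₀ p₁ ϖ τ hϖ hτ ⟶
    Y.orbitObj (f.idx s) (p₀ ≫ f.f₀) p₁' ϖ' τ' hϖ' hτ' where
  idx ρ := ⟨τ' ≫ ρ.2.choose.hom.left, (Over.map f.f₀).mapIso ρ.2.choose, rfl⟩
  f₀ := 𝟙 Z₀
  f₁ := r
  f₀_str := by
    change 𝟙 Z₀ ≫ (p₀ ≫ f.f₀) ≫ Y.str₀ = p₀ ≫ X.str₀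
    rw [Category.id_comp, Category.assoc, f.f₀_str]
  f₁_str := by
    change r ≫ p₁' ≫ Y.str₁ = p₁ ≫ X.str₁
    rw [reassoc_of% hr, f.f₁_str]
  π₁_comm := (Category.comp_id ϖ).trans hrϖ.symm
  σ_comm ρ := by
    change ρ.1 ≫ 𝟙 Z₀ = r ≫ τ' ≫ ρ.2.choose.hom.left
    rw [Category.comp_id, reassoc_of% hrτ]
    exact ρ.2.choose_spec

lemma orbitHom_comp_orbitMap : orbitHom f s hϖ hτ hϖ' hτ' r hr hrϖ hrτ ≫
    Y.orbitMap (f.idx s) (p₀ ≫ f.f₀) p₁' ϖ' τ' hϖ' hτ' = X.orbitMap s p₀ p₁ ϖ τ hϖ hτ ≫ f :=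
  Hom.ext rfl (Category.id_comp _) hr

end OrbitHom

section Closure

variable {X Y : TwistedDiagram.{u} ς}

lemma isPullback_twist (f : X ⟶ Y) : IsPullback X.twistProj (Hom.twist f) f.f₀ Y.twistProj := by
  have h (Z : TwistedDiagram.{u} ς) :
      IsPullback Z.twistProj Z.twistStr Z.str₀ (Spec.map (CommRingCat.ofHom ς)) :=
    .of_hasPullback _ _
  refine .of_bot ?_ (Hom.twist_twistProj f).symm (h Y)
  rw [Hom.twist_twistStr, f.f₀_str]
  exact h X

lemma exists_comparison {f : X ⟶ Y} (hf₀ : finiteEtale f.f₀) [ConnectedSpace X.X₀]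
    [ConnectedSpace Y.X₀] [ConnectedSpace X.twist] {P₀ P' : Scheme.{u}} {q : P₀ ⟶ X.X₀}
    {q' : P' ⟶ X.twist} (hq : IsGaloisClosure q f.f₀) (hq' : IsGaloisCover (q' ≫ Hom.twist f)) :
    ∃ c : P' ⟶ P₀, c ≫ q = q' ≫ X.twistProj := by
  have := hq'.connected
  have sq := isPullback_twist f
  have hsplits := (hq'.splits (MorphismProperty.of_isPullback sq hf₀)).of_isPullback sq
  rw [Category.assoc, ← sq.w, ← Category.assoc] at hsplits
  exact hq.exists_comp_eq_of_splits hf₀ hsplits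

lemma isAlmostDirectGaloisCover_closureMap [Subsingleton Y.Idx] (t : Y.Idx)
    (hY : Y.IsAlmostDirectPresentation) [ConnectedSpace Y.X₁] {P₀ P' : Scheme.{u}}
    {a : P₀ ⟶ Y.X₀} {a' : P' ⟶ Y.twist} (ha : IsGaloisCover a) (ha' : IsGaloisCover a')
    {c : P' ⟶ P₀} (hc : c ≫ a = a' ≫ Y.twistProj) {U : (Y.fibreProd t a a').Opens}
    (hU : IsComponent U) : IsAlmostDirectGaloisCover (Y.closureMap t a a' c hc U) :=
  Y.isAlmostDirectGaloisCover_orbitMap t _ _ hY ha (Y.isGaloisCover_fibreProd_component t ha ha' hU)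

variable (f : X ⟶ Y) (s : X.Idx) {P₀ P' : Scheme.{u}} (a : P₀ ⟶ X.X₀) (a' : P' ⟶ X.twist)

lemma fibreProdMap_fst : fibreProdMap f s a a' ≫
    Y.fibreProdFst (f.idx s) (a ≫ f.f₀) (a' ≫ Hom.twist f) = X.fibreProdFst s a a' :=
  (pullback.lift_fst_assoc _ _ _ _).trans (pullback.lift_fst _ _ _)

lemma fibreProdMap_snd : fibreProdMap f s a a' ≫
    Y.fibreProdSnd (f.idx s) (a ≫ f.f₀) (a' ≫ Hom.twist f) = X.fibreProdSnd s a a' :=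
  (pullback.lift_fst_assoc _ _ _ _).trans (pullback.lift_snd _ _ _)

lemma fibreProdMap_base : fibreProdMap f s a a' ≫
    Y.fibreProdBase (f.idx s) (a ≫ f.f₀) (a' ≫ Hom.twist f) = X.fibreProdBase s a a' ≫ f.f₁ :=
  pullback.lift_snd _ _ _

variable {c : P' ⟶ P₀} (hc : c ≫ a = a' ≫ X.twistProj) (U : (X.fibreProd s a a').Opens)
  (V : (Y.fibreProd (f.idx s) (a ≫ f.f₀) (a' ≫ Hom.twist f)).Opens)
  (hUV : U ≤ fibreProdMap f s a a' ⁻¹ᵁ V)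

/-- The morphism between the objects attached to open subschemes `U` and `V` of the two fibre
products which consists of the identity of `P₀` and of the restriction `U ⟶ V` of
`fibreProdMap`. -/
noncomputable def closureHom : X.closureObj s a a' c hc U ⟶
    Y.closureObj (f.idx s) (a ≫ f.f₀) (a' ≫ Hom.twist f) c (comparison_comp f hc) V :=
  orbitHom f s _ _ _ _ ((fibreProdMap f s a a').resLE V U hUV)
    (by rw [Scheme.Hom.resLE_comp_ι_assoc, fibreProdMap_base, Category.assoc])
    (by rw [Scheme.Hom.resLE_comp_ι_assoc, fibreProdMap_fst])
    (by rw [Scheme.Hom.resLE_comp_ι_assoc, reassoc_of% fibreProdMap_snd])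

lemma closureHom_comp_closureMap : closureHom f s a a' hc U V hUV ≫
    Y.closureMap (f.idx s) (a ≫ f.f₀) (a' ≫ Hom.twist f) c (comparison_comp f hc) V =
      X.closureMap s a a' c hc U ≫ f :=
  orbitHom_comp_orbitMap ..

end Closure

end TwistedDiagram

theorem mainTheorem9_general {R : Type u} [CommRing R] {ς : R →+* R}
    {X Y : TwistedDiagram.{u} ς} [Subsingleton X.Idx] [Subsingleton Y.Idx] (s : X.Idx)
    (hX : X.IsAlmostDirectPresentation) (hY : Y.IsAlmostDirectPresentation)
    (hXconn : X.IsDirectly fun Z => ConnectedSpace Z)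
    (hYconn : Y.IsDirectly fun Z => ConnectedSpace Z) (f : X ⟶ Y) (hf₀ : finiteEtale f.f₀) :
    (∃ (P₀ : Scheme.{u}) (q : P₀ ⟶ X.X₀), IsGaloisClosure q f.f₀) ∧
    (∃ (P' : Scheme.{u}) (q' : P' ⟶ X.twist), IsGaloisClosure q' (TwistedDiagram.Hom.twist f)) ∧
    ∀ (P₀ P' : Scheme.{u}) (q : P₀ ⟶ X.X₀) (q' : P' ⟶ X.twist),
      IsGaloisClosure q f.f₀ → IsGaloisClosure q' (TwistedDiagram.Hom.twist f) →
      (∃ U : (X.fibreProd s q q').Opens, IsComponent U) ∧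
      (∀ U : (X.fibreProd s q q').Opens, IsComponent U →
        ∃ V : (Y.fibreProd (f.idx s) (q ≫ f.f₀) (q' ≫ TwistedDiagram.Hom.twist f)).Opens,
          IsComponent V ∧ U ≤ TwistedDiagram.fibreProdMap f s q q' ⁻¹ᵁ V) ∧
      (∃ c : P' ⟶ P₀, c ≫ q = q' ≫ X.twistProj) ∧
      ∀ (c : P' ⟶ P₀) (hc : c ≫ q = q' ≫ X.twistProj)
        (U : (X.fibreProd s q q').Opens)
        (V : (Y.fibreProd (f.idx s) (q ≫ f.f₀) (q' ≫ TwistedDiagram.Hom.twist f)).Opens)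
        (hUV : U ≤ TwistedDiagram.fibreProdMap f s q q' ⁻¹ᵁ V),
        IsComponent U → IsComponent V →
        TwistedDiagram.IsAlmostDirectGaloisCover (X.closureMap s q q' c hc U) ∧
        TwistedDiagram.IsAlmostDirectGaloisCover
          (Y.closureMap (f.idx s) (q ≫ f.f₀) (q' ≫ TwistedDiagram.Hom.twist f) c
            (TwistedDiagram.comparison_comp f hc) V) ∧
        ∃ j : X.closureObj s q q' c hc U ⟶
            Y.closureObj (f.idx s) (q ≫ f.f₀) (q' ≫ TwistedDiagram.Hom.twist f) c
              (TwistedDiagram.comparison_comp f hc) V,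
          j.f₀ = 𝟙 P₀ ∧ j.f₁ = (TwistedDiagram.fibreProdMap f s q q').resLE V U hUV ∧
          j ≫ Y.closureMap (f.idx s) (q ≫ f.f₀) (q' ≫ TwistedDiagram.Hom.twist f) c
              (TwistedDiagram.comparison_comp f hc) V =
            X.closureMap s q q' c hc U ≫ f := by
  obtain ⟨_, _, _⟩ := hXconn
  obtain ⟨_, _, _⟩ := hYconn
  have hf' : finiteEtale (TwistedDiagram.Hom.twist f) :=
    MorphismProperty.of_isPullback (TwistedDiagram.isPullback_twist f) hf₀
  refine ⟨hf₀.exists_isGaloisClosure, hf'.exists_isGaloisClosure, fun P₀ P' q q' hq hq' => ?_⟩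
  have hG₀ : IsGaloisCover (q ≫ f.f₀) := hq.isGaloisCover
  have hG' : IsGaloisCover (q' ≫ TwistedDiagram.Hom.twist f) := hq'.isGaloisCover
  have hg₀ : IsGaloisCover q := hG₀.of_comp hf₀
  have hg' : IsGaloisCover q' := hG'.of_comp hf'
  exact ⟨X.exists_isComponent_fibreProd s hg₀ hg',
    fun U hU => hU.exists_le_preimage _
      (Y.fibreProdBase_mem (f.idx s) finiteEtale hG₀.finiteEtale hG'.finiteEtale),
    TwistedDiagram.exists_comparison hf₀ hq hG',
    fun c hc U V hUV hU hV =>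
      ⟨TwistedDiagram.isAlmostDirectGaloisCover_closureMap s hX hg₀ hg' hc hU,
        TwistedDiagram.isAlmostDirectGaloisCover_closureMap (f.idx s) hY hG₀ hG' _ hV,
        TwistedDiagram.closureHom f s q q' hc U V hUV, rfl, rfl,
        TwistedDiagram.closureHom_comp_closureMap f s q q' hc U V hUV⟩⟩

theorem mainTheorem9 {R : Type u} [CommRing R] [IsDomain R] (ς : R →+* R)
    (hς : Function.Injective ς) (X Y : TwistedDiagram.{u} ς) [Unique X.Idx] [Unique Y.Idx]
    (hX : X.IsAlmostDirectPresentation) (hY : Y.IsAlmostDirectPresentation)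
    (hXint : X.IsDirectly IsIntegral) (hYint : Y.IsDirectly IsIntegral)
    (f : X ⟶ Y) (hf : TwistedDiagram.Hom.IsDirectly finiteEtale f) :
    (∃ (P₀ : Scheme.{u}) (q : P₀ ⟶ X.X₀), IsGaloisClosure q f.f₀) ∧
    (∃ (P' : Scheme.{u}) (q' : P' ⟶ X.twist), IsGaloisClosure q' (TwistedDiagram.Hom.twist f)) ∧
    ∀ (P₀ P' : Scheme.{u}) (q : P₀ ⟶ X.X₀) (q' : P' ⟶ X.twist),
      IsGaloisClosure q f.f₀ → IsGaloisClosure q' (TwistedDiagram.Hom.twist f) →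
      (∃ U : (X.fibreProd default q q').Opens, IsComponent U) ∧
      (∀ U : (X.fibreProd default q q').Opens, IsComponent U →
        ∃ V : (Y.fibreProd (f.idx default) (q ≫ f.f₀) (q' ≫ TwistedDiagram.Hom.twist f)).Opens,
          IsComponent V ∧ U ≤ TwistedDiagram.fibreProdMap f default q q' ⁻¹ᵁ V) ∧
      (∃ c : P' ⟶ P₀, c ≫ q = q' ≫ X.twistProj) ∧
      ∀ (c : P' ⟶ P₀) (hc : c ≫ q = q' ≫ X.twistProj)
        (U : (X.fibreProd default q q').Opens)
        (V : (Y.fibreProd (f.idx default) (q ≫ f.f₀) (q' ≫ TwistedDiagram.Hom.twist f)).Opens)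
        (hUV : U ≤ TwistedDiagram.fibreProdMap f default q q' ⁻¹ᵁ V),
        IsComponent U → IsComponent V →
        TwistedDiagram.IsAlmostDirectGaloisCover (X.closureMap default q q' c hc U) ∧
        TwistedDiagram.IsAlmostDirectGaloisCover
          (Y.closureMap (f.idx default) (q ≫ f.f₀) (q' ≫ TwistedDiagram.Hom.twist f) c
            (TwistedDiagram.comparison_comp f hc) V) ∧
        ∃ j : X.closureObj default q q' c hc U ⟶
            Y.closureObj (f.idx default) (q ≫ f.f₀) (q' ≫ TwistedDiagram.Hom.twist f) c
              (TwistedDiagram.comparison_comp f hc) V,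
          j.f₀ = 𝟙 P₀ ∧ j.f₁ = (TwistedDiagram.fibreProdMap f default q q').resLE V U hUV ∧
          j ≫ Y.closureMap (f.idx default) (q ≫ f.f₀) (q' ≫ TwistedDiagram.Hom.twist f) c
              (TwistedDiagram.comparison_comp f hc) V =
            X.closureMap default q q' c hc U ≫ f := by
  obtain ⟨_, _, _⟩ := hXint
  obtain ⟨_, _, _⟩ := hYint
  exact mainTheorem9_general default hX hY ⟨inferInstance, inferInstance, inferInstance⟩
    ⟨inferInstance, inferInstance, inferInstance⟩ f hf.1
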